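/- **Setting.** Let $p$ be a number of atoms, $s=(s_1,\dots,s_p)$ with $s_i\in\{1,\dots,p\}$ the vector of atom types, $G$ an undirected simple graph on $\{1,\dots,p\}$ and $\mathcal N_i$ the set of neighbours of $i$ in $G$. Let $N\subseteq\mathbb R^{p\times p}$ be the set of matrices $X$ for which there are $\kappa_i>0$ and $\beta_{ij}\in\mathbb R$ ($1\le i,j\le p$), with $\kappa_i=\kappa_j$ if $s_i=s_j$, and $\beta_{ij}=\beta_{kl}$ if $s_i=s_k$ and $s_j=s_l$, such that $X_{ii}=1/\kappa_i$, $X_{ij}=-\beta_{ij}/\kappa_i$ if $j\in\mathcal N_i$, and $X_{ij}=0$ if $i\ne j$ and $j\notin\mathcal N_i$. Let $\varepsilon>0$ and let $M$ be the set of symmetric $X\in\mathbb R^{p\times p}$ with $X-\varepsilon I\succeq 0$. Let $\nu>p-1$, let $B\in\mathbb R^{p\times p}$ be symmetric positive definite, $x\in\mathbb R^p$ a (column) vector, $S=xx^{T}$, and $$F(X)=-(\nu-p)\log\det X+\operatorname{tr}\big((B^{-1}+S)X\big),\qquad P_\gamma(X,Y)=F(X)+\tfrac{\gamma}{2}\|X-Y\|_F^2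 ,$$ where $\|\cdot\|_F$ is the Frobenius norm. The constrained MAP problem is $$\min\{F(X):\ X\in M\cap N\}.\qquad(\ast)$$ **Algorithm.** Let $(\epsilon^k)_{k\ge0}$ be a decreasing sequence of positive numbers with $\epsilon^k\to0$, let $\gamma^0>0$, $\eta>1$ and $\gamma^k=\eta^k\gamma^0$. Put $X^0=I$ and let $Y^0$ be any symmetric positive definite matrix. For $k=0,1,2,\dots$, start the inner loop at $(X^k_0,Y^k_0)=(X^k,Y^k)$ and, as long as $l=0$ or $$\max\big\{\|(X^k_l-X^k_{l-1})+\gamma^k(Y^k_l-Y^k_{l-1})\|_F,\ \|Y^k_l-Y^k_{l-1}\|_F\big\}>\epsilon^k,$$ choose $$X^k_{l+1}\in\arg\min_{X\in M}\Big\{P_{\gamma^k}(X,Y^k_l)+\tfrac12\|X-X^k_l\|_F^2\Big\},\qquad Y^k_{l+1}\in\arg\min_{Y\in N}\Big\{P_{\gamma^k}(X^k_{l+1},Y)+\tfrac12\|Y-Y^k_l\|_F^2\Big\}$$ and increase $l$ by one. When the loop is left at $l$, put $(X^{k+1},Y^{k+1})=(X^k_l,Y^k_l)$. **Theorem 5.**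 Let $\{(X^k,Y^k)\}_{k\ge0}$ be generated by this algorithm. Every inner loop is left after finitely many steps, and: (i) the sequence $\{(X^k,Y^k)\}$ is bounded; (ii) $\lim_{k\to\infty}\|X^k-Y^k\|_F=0$; (iii) if $(X^\star,Y^\star)$ is an accumulation point of $\{(X^k,Y^k)\}$, then $X^\star=Y^\star$, and $X^\star$ is the unique global minimizer of $(\ast)$. -/

import Mathlib

open Filter Topology

namespace Cargo

noncomputable section

/-- The Frobenius norm `‖X‖_F = √(tr (X Xᵀ))`. -/
def frobNorm {p : ℕ} (X : Matrix (Fin p) (Fin p) ℝ) : ℝ :=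
  √((X * X.transpose).trace)

/-- `F(X) = -(ν - p) log (det X) + tr ((B⁻¹ + S) X)` with the sample covariance matrix `S = x xᵀ`
of the (centred) observation `x`: up to factor and constant, the negative log-posterior. -/
def objective {p : ℕ} (ν : ℝ) (B : Matrix (Fin p) (Fin p) ℝ) (x : Fin p → ℝ)
    (X : Matrix (Fin p) (Fin p) ℝ) : ℝ :=
  -(ν - p) * Real.log X.det + ((B⁻¹ + Matrix.vecMulVec x x) * X).trace

/-- The penalised objective `P_γ(X, Y) = F(X) + (γ / 2) ‖X - Y‖_F²`. -/
def penalty {p : ℕ} (ν : ℝ) (B : Matrix (Fin p) (Fin p) ℝ) (x : Fin p → ℝ) (γ : ℝ)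
    (X Y : Matrix (Fin p) (Fin p) ℝ) : ℝ :=
  objective ν B x X + γ / 2 * frobNorm (X - Y) ^ 2

/-- `M = {X symmetric : X - ε I ⪰ 0}` (`Matrix.PosSemidef` includes symmetry). -/
def eigSet (p : ℕ) (ε : ℝ) : Set (Matrix (Fin p) (Fin p) ℝ) :=
  {X | (X - ε • (1 : Matrix (Fin p) (Fin p) ℝ)).PosSemidef}

/-- The graph constraint set `N`: matrices `X` with `X i i = 1 / κ i`, `X i j = -β i j / κ i` for
neighbours `i, j`, and `X i j = 0` for distinct non-neighbours, where the conditional variances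
`κ i > 0` depend on the type of the atom `i` only, and the spatial coefficients `β i j` on the
types of `i` and `j` only. -/
def graphSet {p : ℕ} (s : Fin p → Fin p) (G : SimpleGraph (Fin p)) :
    Set (Matrix (Fin p) (Fin p) ℝ) :=
  {X | ∃ (κ : Fin p → ℝ) (β : Fin p → Fin p → ℝ),
    (∀ i, 0 < κ i) ∧
    (∀ i j, s i = s j → κ i = κ j) ∧
    (∀ i j k l, s i = s k → s j = s l → β i j = β k l) ∧
    (∀ i, X i i = 1 / κ i) ∧
    (∀ i j, G.Adj i j → X i j = -β i j / κ i) ∧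
    (∀ i j, i ≠ j → ¬ G.Adj i j → X i j = 0)}

/-- `a` is a global minimizer of `f` over `S`. -/
def IsMinimizer {α : Type*} (f : α → ℝ) (S : Set α) (a : α) : Prop :=
  a ∈ S ∧ ∀ b ∈ S, f a ≤ f b

/-- `a` is *the* (unique) global minimizer of `f` over `S`. -/
def IsTheMinimizer {α : Type*} (f : α → ℝ) (S : Set α) (a : α) : Prop :=
  IsMinimizer f S a ∧ ∀ b, IsMinimizer f S b → b = a

/-- The guard of the inner `while` loop, evaluated when the inner counter has the value `l`:
`l = 0` or `max {‖(X_l - X_{l-1}) + γ (Y_l - Y_{l-1})‖_F, ‖Y_l - Y_{l-1}‖_F} > tol`.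
(The truncated value of `l - 1` is irrelevant at `l = 0`, where the first disjunct holds.) -/
def Continues {p : ℕ} (γ tol : ℝ) (X Y : ℕ → Matrix (Fin p) (Fin p) ℝ) (l : ℕ) : Prop :=
  l = 0 ∨
    tol < max (frobNorm ((X l - X (l - 1)) + γ • (Y l - Y (l - 1)))) (frobNorm (Y l - Y (l - 1)))

/-- The inner `while` loop is left when the inner counter has the value `L`. -/
def ExitsAt {p : ℕ} (γ tol : ℝ) (X Y : ℕ → Matrix (Fin p) (Fin p) ℝ) (L : ℕ) : Prop :=
  (∀ j < L, Continues γ tol X Y j) ∧ ¬ Continues γ tol X Y L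

/-- A run of the penalty decomposition algorithm with proximal Gauss-Seidel inner loops.
`X k, Y k` are the outer iterates, `XI k l, YI k l` the inner iterates of the `k`-th inner loop;
`γ₀`, `η` determine the penalty parameters `γ^k = η^k γ₀`, and `tol k` is the inner tolerance.
An inner step is prescribed only while the guard holds, and the next outer iterate only if the
inner loop is left; that it is left is not part of the definition. -/
structure IsRun {p : ℕ} (s : Fin p → Fin p) (G : SimpleGraph (Fin p)) (ν : ℝ)
    (B : Matrix (Fin p) (Fin p) ℝ) (x : Fin p → ℝ) (ε γ₀ η : ℝ) (tol : ℕ → ℝ)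
    (X Y : ℕ → Matrix (Fin p) (Fin p) ℝ) (XI YI : ℕ → ℕ → Matrix (Fin p) (Fin p) ℝ) : Prop where
  X_zero : X 0 = 1
  Y_zero : (Y 0).PosDef
  XI_zero : ∀ k, XI k 0 = X k
  YI_zero : ∀ k, YI k 0 = Y k
  X_step : ∀ k l, (∀ j ≤ l, Continues (η ^ k * γ₀) (tol k) (XI k) (YI k) j) →
    IsMinimizer
      (fun Z => penalty ν B x (η ^ k * γ₀) Z (YI k l) + 1 / 2 * frobNorm (Z - XI k l) ^ 2)
      (eigSet p ε) (XI k (l + 1))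
  Y_step : ∀ k l, (∀ j ≤ l, Continues (η ^ k * γ₀) (tol k) (XI k) (YI k) j) →
    IsMinimizer
      (fun W => penalty ν B x (η ^ k * γ₀) (XI k (l + 1)) W + 1 / 2 * frobNorm (W - YI k l) ^ 2)
      (graphSet s G) (YI k (l + 1))
  X_succ : ∀ k L, ExitsAt (η ^ k * γ₀) (tol k) (XI k) (YI k) L → X (k + 1) = XI k L
  Y_succ : ∀ k L, ExitsAt (η ^ k * γ₀) (tol k) (XI k) (YI k) L → Y (k + 1) = YI k L

end

end Cargo

/-! ### Trace inequalities and concavity of log det -/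

namespace Matrix

open scoped MatrixOrder

variable {n : Type*} [Fintype n] [DecidableEq n]

/-! Each inner step minimizes over a convex set, so it yields a variational inequality. Added at a
common test point Z of M ∩ N, the two inequalities have penalty terms that collapse to -γ‖X - Y‖²,
and the remaining error is exactly what the stopping test bounds (`approximate_optimality`).

Testing with Z = εI, which lies in both sets, bounds a‖X‖ + γ‖X - Y‖² (`exists_apriori_bound`).
Since γ^k → ∞, this gives boundedness and ‖X - Y‖ → 0. At an accumulation point the penalty term has
a favourable sign and the error vanishes, so the slope of F towards every feasible Z is nonnegative.
The limit is feasible because M is closed and forces the diagonal to stay at least ε, which excludes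
the only way of leaving N.

Stationarity implies unique global minimality for either sign of ν - p
(`isTheMinimizer_of_stationary`). If ν > p, F is strictly convex. Otherwise F is concave on positive
definite matrices and decreases from every point of M towards εI, which is then the only stationary
point.

Inner loops end because every step lowers a penalty function that is bounded below (`descent`,
`bddBelow_penalty`). -/

theorem PosSemidef.trace_mul_nonneg {A B : Matrix n n ℝ} (hA : A.PosSemidef)
    (hB : B.PosSemidef) : 0 ≤ (A * B).trace := by
  obtain ⟨C, rfl⟩ := CStarAlgebra.nonneg_iff_eq_star_mul_self.mp hA.nonneg
  rw [star_eq_conjTranspose, Matrix.mul_assoc, trace_mul_comm]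
  exact (hB.mul_mul_conjTranspose_same C).trace_nonneg

/-- The spectrum of A is bounded below by some a > 0, so A - aI is positive semidefinite. This is
the coercivity of the linear part of F. -/
theorem PosDef.exists_pos_smul_trace_le {A : Matrix n n ℝ} (hA : A.PosDef) :
    ∃ a : ℝ, 0 < a ∧ ∀ X : Matrix n n ℝ, X.PosSemidef → a * X.trace ≤ (A * X).trace := by
  rcases isEmpty_or_nonempty n with h | h
  · exact ⟨1, one_pos, fun X _ => by simp [trace]⟩
  obtain ⟨a, ha, haA⟩ := (CFC.exists_pos_algebraMap_le_iff (A := Matrix n n ℝ) (a := A)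
    hA.isHermitian).2 (fun x hx => by
      rw [hA.isHermitian.spectrum_real_eq_range_eigenvalues] at hx
      obtain ⟨i, rfl⟩ := hx
      exact hA.eigenvalues_pos i)
  refine ⟨a, ha, fun X hX => ?_⟩
  have h := PosSemidef.trace_mul_nonneg (le_iff.1 haA) hX
  rw [Matrix.sub_mul, trace_sub, Algebra.algebraMap_eq_smul_one, smul_mul, Matrix.one_mul,
    trace_smul, smul_eq_mul] at h
  linarith

/-- `log det C ≤ tr C - n`, with equality only at the identity. -/
theorem PosDef.log_det_le {C : Matrix n n ℝ} (hC : C.PosDef) :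
    Real.log C.det ≤ (C - 1).trace ∧ (Real.log C.det = (C - 1).trace → C = 1) := by
  have hpos := hC.eigenvalues_pos
  have hdet : Real.log C.det = ∑ i, Real.log (hC.1.eigenvalues i) := by
    rw [hC.1.det_eq_prod_eigenvalues]
    exact Real.log_prod fun i _ => (hpos i).ne'
  have htr : (C - 1).trace = ∑ i, (hC.1.eigenvalues i - 1) := by
    rw [trace_sub, hC.1.trace_eq_sum_eigenvalues]
    simp
  have hle : ∀ i ∈ Finset.univ, Real.log (hC.1.eigenvalues i) ≤ hC.1.eigenvalues i - 1 :=
    fun i _ => Real.log_le_sub_one_of_pos (hpos i)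
  rw [hdet, htr]
  refine ⟨Finset.sum_le_sum hle, fun h => ?_⟩
  have h1 : ∀ i, hC.1.eigenvalues i = 1 := by
    intro i
    by_contra hne
    exact (Real.log_lt_sub_one_of_pos (hpos i) hne).ne
      ((Finset.sum_eq_sum_iff_of_le hle).1 h i (Finset.mem_univ i))
  have h2 : hC.1.eigenvalues = fun _ => 1 := funext h1
  have := hC.1.spectral_theorem
  rw [h2] at this
  rw [this]
  have h3 : diagonal ((RCLike.ofReal : ℝ → ℝ) ∘ fun _ : n => (1 : ℝ)) = 1 := by
    ext i j; simp [diagonal_apply, one_apply]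
  rw [h3, map_one]

/-- Concavity of `log det`: it lies below its tangents, strictly off the point of tangency. -/
theorem PosDef.log_det_le_tangent {X Z : Matrix n n ℝ} (hX : X.PosDef) (hZ : Z.PosDef) :
    Real.log Z.det ≤ Real.log X.det + (X⁻¹ * (Z - X)).trace ∧
      (Real.log Z.det = Real.log X.det + (X⁻¹ * (Z - X)).trace → Z = X) := by
  -- With X⁻¹ = QᴴQ, congruence by Q sends X to the identity and reduces the claim to
  -- `PosDef.log_det_le`.
  obtain ⟨Q, hQ⟩ := CStarAlgebra.nonneg_iff_eq_star_mul_self.mp hX.inv.posSemidef.nonneg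
  rw [star_eq_conjTranspose] at hQ
  have hdX := hX.det_pos
  have hXu : IsUnit X.det := hdX.ne'.isUnit
  have hdQ : (X.det)⁻¹ = Q.det * Q.det := by
    have := congrArg det hQ
    rwa [det_nonsing_inv, Ring.inverse_eq_inv', det_mul, conjTranspose_eq_transpose_of_trivial,
      det_transpose] at this
  have hQ0 : Q.det ≠ 0 := by
    intro h
    rw [h, mul_zero] at hdQ
    exact hdX.ne' (inv_eq_zero.1 hdQ)
  have hQu : IsUnit Q := (isUnit_iff_isUnit_det Q).2 hQ0.isUnit
  have hC : (Q * Z * Qᴴ).PosDef := by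
    refine hZ.mul_mul_conjTranspose_same ?_
    exact vecMul_injective_of_isUnit hQu
  have hone : Q * X * Qᴴ = 1 := by
    have h1 : Qᴴ * (Q * X) = 1 := by rw [← Matrix.mul_assoc, ← hQ, nonsing_inv_mul _ hXu]
    exact mul_eq_one_comm.1 h1
  have hdet : Real.log (Q * Z * Qᴴ).det = Real.log Z.det - Real.log X.det := by
    rw [det_mul, det_mul, conjTranspose_eq_transpose_of_trivial, det_transpose,
      mul_right_comm, ← hdQ, Real.log_mul (inv_ne_zero hdX.ne') hZ.det_pos.ne', Real.log_inv]
    ring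
  have htr : (Q * Z * Qᴴ - 1).trace = (X⁻¹ * (Z - X)).trace := by
    rw [← hone, ← Matrix.sub_mul, ← Matrix.mul_sub, trace_mul_comm, ← Matrix.mul_assoc, ← hQ]
  have h := hC.log_det_le
  rw [hdet, htr] at h
  refine ⟨by linarith [h.1], fun he => ?_⟩
  have h1 := h.2 (by linarith)
  rw [← hone] at h1
  have hQHu : IsUnit Qᴴ := by
    rw [isUnit_iff_isUnit_det, conjTranspose_eq_transpose_of_trivial, det_transpose]
    exact hQ0.isUnit
  exact hQu.mul_left_cancel (hQHu.mul_right_cancel h1)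

theorem isClosed_setOf_posSemidef {m : Type*} [Fintype m] :
    IsClosed {X : Matrix m m ℝ | X.PosSemidef} := by
  simp only [posSemidef_iff_dotProduct_mulVec, IsHermitian, Set.ofPred_and, Set.ofPred_forall]
  refine IsClosed.inter (isClosed_eq (by fun_prop) (by fun_prop)) (isClosed_iInter fun v => ?_)
  exact isClosed_le continuous_const (by fun_prop)

end Matrix

/-! ### The Frobenius norm as a Euclidean norm -/

namespace Cargo

variable {p : ℕ}

/-- The entries of a matrix as a Euclidean vector. -/
noncomputable def frobVec : Matrix (Fin p) (Fin p) ℝ →ₗ[ℝ] EuclideanSpace ℝ (Fin p × Fin p) where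
  toFun X := WithLp.toLp 2 fun ij => X ij.1 ij.2
  map_add' X Y := by ext; simp
  map_smul' c X := by ext; simp

theorem frobVec_apply (X : Matrix (Fin p) (Fin p) ℝ) (i j : Fin p) : frobVec X (i, j) = X i j := rfl

theorem inner_frobVec (X Y : Matrix (Fin p) (Fin p) ℝ) :
    inner ℝ (frobVec X) (frobVec Y) = ∑ i, ∑ j, X i j * Y i j := by
  rw [PiLp.inner_apply, Fintype.sum_prod_type]
  simp [frobVec_apply, mul_comm]

theorem frobNorm_eq_norm (X : Matrix (Fin p) (Fin p) ℝ) : frobNorm X = ‖frobVec X‖ := by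
  rw [frobNorm, norm_eq_sqrt_real_inner, inner_frobVec]
  simp [Matrix.trace, Matrix.mul_apply]

theorem continuous_frobVec : Continuous (frobVec (p := p)) :=
  LinearMap.continuous_of_finiteDimensional _

theorem continuous_frobNorm : Continuous (frobNorm (p := p)) := by
  simp only [funext frobNorm_eq_norm]
  exact continuous_frobVec.norm

section
attribute [local instance] Matrix.frobeniusNormedAddCommGroup

theorem frobNorm_eq_frobenius (X : Matrix (Fin p) (Fin p) ℝ) : frobNorm X = ‖X‖ := by
  rw [Matrix.frobenius_norm_def, frobNorm, Real.sqrt_eq_rpow]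
  simp [Matrix.trace, Matrix.mul_apply, pow_two]

open scoped MatrixOrder in
-- Writing X = QᴴQ, submultiplicativity gives ‖X‖ ≤ ‖Q‖² = tr X.
theorem frobNorm_le_trace {X : Matrix (Fin p) (Fin p) ℝ} (hX : X.PosSemidef) :
    frobNorm X ≤ X.trace := by
  obtain ⟨Q, rfl⟩ := CStarAlgebra.nonneg_iff_eq_star_mul_self.mp hX.nonneg
  rw [frobNorm_eq_frobenius, Matrix.star_eq_conjTranspose]
  refine (Matrix.frobenius_norm_mul _ _).trans ?_
  rw [Matrix.frobenius_norm_conjTranspose, ← frobNorm_eq_frobenius, frobNorm,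
    Matrix.trace_mul_comm, Matrix.conjTranspose_eq_transpose_of_trivial]
  refine (Real.mul_self_sqrt ?_).le
  have := (Matrix.posSemidef_conjTranspose_mul_self Q).trace_nonneg
  rwa [Matrix.conjTranspose_eq_transpose_of_trivial] at this
end

end Cargo

/-! ### The log-determinant objective and its slope -/

namespace Cargo

variable {p : ℕ}

/-- The objective `-c log det X + tr (A X)` with a general coefficient of either sign. -/
noncomputable def logDetObj (c : ℝ) (A X : Matrix (Fin p) (Fin p) ℝ) : ℝ :=
  -c * Real.log X.det + (A * X).trace

/-- The directional derivative of `logDetObj c A` at `X` along `D`. -/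
noncomputable def logDetSlope (c : ℝ) (A X D : Matrix (Fin p) (Fin p) ℝ) : ℝ :=
  -c * (X⁻¹ * D).trace + (A * D).trace

theorem logDetObj_tangent_le {c : ℝ} (hc : 0 ≤ c) (A : Matrix (Fin p) (Fin p) ℝ)
    {X Z : Matrix (Fin p) (Fin p) ℝ} (hX : X.PosDef) (hZ : Z.PosDef) :
    logDetObj c A X + logDetSlope c A X (Z - X) ≤ logDetObj c A Z := by
  have h := mul_le_mul_of_nonneg_left (hX.log_det_le_tangent hZ).1 hc
  simp only [logDetObj, logDetSlope, Matrix.mul_sub A, Matrix.trace_sub]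
  linarith

theorem eq_of_logDetObj_tangent_eq {c : ℝ} (hc : 0 < c) (A : Matrix (Fin p) (Fin p) ℝ)
    {X Z : Matrix (Fin p) (Fin p) ℝ} (hX : X.PosDef) (hZ : Z.PosDef)
    (h : logDetObj c A Z ≤ logDetObj c A X + logDetSlope c A X (Z - X)) : Z = X := by
  obtain ⟨h1, h2⟩ := hX.log_det_le_tangent hZ
  refine h2 (le_antisymm h1 (le_of_mul_le_mul_left ?_ hc))
  simp only [logDetObj, logDetSlope, Matrix.mul_sub A, Matrix.trace_sub] at h
  linarith

theorem logDetObj_le_tangent {c : ℝ} (hc : c ≤ 0) (A : Matrix (Fin p) (Fin p) ℝ)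
    {X Z : Matrix (Fin p) (Fin p) ℝ} (hX : X.PosDef) (hZ : Z.PosDef) :
    logDetObj c A Z ≤ logDetObj c A X + logDetSlope c A X (Z - X) := by
  have h := mul_le_mul_of_nonneg_left (hX.log_det_le_tangent hZ).1 (neg_nonneg.2 hc)
  simp only [logDetObj, logDetSlope, Matrix.mul_sub A, Matrix.trace_sub]
  linarith

theorem logDetSlope_smul (c : ℝ) (A X D : Matrix (Fin p) (Fin p) ℝ) (t : ℝ) :
    logDetSlope c A X (t • D) = t * logDetSlope c A X D := by
  simp only [logDetSlope, Matrix.mul_smul, Matrix.trace_smul, smul_eq_mul]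
  ring

theorem tendsto_logDetSlope (c : ℝ) (A : Matrix (Fin p) (Fin p) ℝ) {ι : Type*} {l : Filter ι}
    {u v : ι → Matrix (Fin p) (Fin p) ℝ} {X D : Matrix (Fin p) (Fin p) ℝ} (hX : X.PosDef)
    (hu : Tendsto u l (𝓝 X)) (hv : Tendsto v l (𝓝 D)) :
    Tendsto (fun k => logDetSlope c A (u k) (v k)) l (𝓝 (logDetSlope c A X D)) := by
  have hinv : Tendsto (fun k => (u k)⁻¹) l (𝓝 X⁻¹) := by
    have hd : Tendsto (fun k => (u k).det) l (𝓝 X.det) :=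
      (Continuous.matrix_det continuous_id).tendsto X |>.comp hu
    have ha : Tendsto (fun k => (u k).adjugate) l (𝓝 X.adjugate) :=
      (Continuous.matrix_adjugate continuous_id).tendsto X |>.comp hu
    simp only [Matrix.inv_def, Ring.inverse_eq_inv']
    exact (hd.inv₀ hX.det_pos.ne').smul ha
  have htr : Continuous fun M : Matrix (Fin p) (Fin p) ℝ => M.trace :=
    Continuous.matrix_trace continuous_id
  exact (((htr.tendsto _).comp (hinv.mul hv)).const_mul _).add
    ((htr.tendsto _).comp (hv.const_mul A))

/-- First-order necessary condition for the log-determinant objective plus a quadratic. -/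
theorem logDetSlope_add_nonneg {c : ℝ} {A X D : Matrix (Fin p) (Fin p) ℝ}
    (hpd : ∀ t : ℝ, 0 ≤ t → t ≤ 1 → (X + t • D).PosDef) {α β : ℝ}
    (h : ∀ t : ℝ, 0 ≤ t → t ≤ 1 →
      logDetObj c A X ≤ logDetObj c A (X + t • D) + t * α + t ^ 2 * β) :
    0 ≤ logDetSlope c A X D + α := by
  have hX : X.PosDef := by simpa using hpd 0 le_rfl zero_le_one
  have hid : Tendsto (fun t : ℝ => t) (𝓝[>] 0) (𝓝 0) := tendsto_nhdsWithin_of_tendsto_nhds tendsto_id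
  have hpath : Tendsto (fun t : ℝ => X + t • D) (𝓝[>] 0) (𝓝 X) := by
    simpa using (hid.smul_const D).const_add X
  have hβ : Tendsto (fun t : ℝ => t * β) (𝓝[>] 0) (𝓝 0) := by simpa using hid.mul_const β
  have hev : ∀ᶠ t : ℝ in 𝓝[>] 0, 0 < t ∧ t ≤ 1 := by
    filter_upwards [Ioc_mem_nhdsGT (zero_lt_one' ℝ)] with t ht using ht
  -- Tangent inequalities replace differentiation. In the convex case the tangent at X + tD is
  -- evaluated at X and its slope converges as t → 0; in the concave case the tangent at X already
  -- suffices.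
  rcases le_total 0 c with hc | hc
  · have hlim := ((tendsto_logDetSlope c A hX hpath (tendsto_const_nhds (x := D))).add_const α).add hβ
    rw [add_zero] at hlim
    refine ge_of_tendsto hlim ?_
    filter_upwards [hev] with t ht
    have h1 := h t ht.1.le ht.2
    have h2 := logDetObj_tangent_le hc A (hpd t ht.1.le ht.2) hX
    rw [show X - (X + t • D) = (-t) • D by simp, logDetSlope_smul] at h2
    have h3 : 0 ≤ t * (logDetSlope c A (X + t • D) D + α + t * β) := by linarith
    exact nonneg_of_mul_nonneg_right h3 ht.1
  · have hlim := hβ.const_add (logDetSlope c A X D + α)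
    rw [add_zero] at hlim
    refine ge_of_tendsto hlim ?_
    filter_upwards [hev] with t ht
    have h1 := h t ht.1.le ht.2
    have h2 := logDetObj_le_tangent hc A hX (hpd t ht.1.le ht.2)
    rw [add_sub_cancel_left, logDetSlope_smul] at h2
    have h3 : 0 ≤ t * (logDetSlope c A X D + α + t * β) := by linarith
    exact nonneg_of_mul_nonneg_right h3 ht.1

/-! ### The spectral constraint set M -/

section eigSet

variable {ε : ℝ} {X Z : Matrix (Fin p) (Fin p) ℝ}

theorem posDef_smul_one (p : ℕ) (hε : 0 < ε) :
    (ε • (1 : Matrix (Fin p) (Fin p) ℝ)).PosDef :=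
  Matrix.PosDef.one.smul hε

theorem posDef_of_mem_eigSet (hε : 0 < ε) (hX : X ∈ eigSet p ε) : X.PosDef := by
  simpa using (posDef_smul_one p hε).add_posSemidef hX

theorem smul_one_mem_eigSet (p : ℕ) (ε : ℝ) :
    ε • (1 : Matrix (Fin p) (Fin p) ℝ) ∈ eigSet p ε := by
  simpa [eigSet] using Matrix.PosSemidef.zero

theorem add_smul_sub_mem_eigSet (hX : X ∈ eigSet p ε) (hZ : Z ∈ eigSet p ε) {t : ℝ}
    (ht0 : 0 ≤ t) (ht1 : t ≤ 1) : X + t • (Z - X) ∈ eigSet p ε := by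
  have h := (Matrix.PosSemidef.smul hX (sub_nonneg.2 ht1)).add (Matrix.PosSemidef.smul hZ ht0)
  have he : X + t • (Z - X) - ε • (1 : Matrix (Fin p) (Fin p) ℝ) =
      (1 - t) • (X - ε • (1 : Matrix (Fin p) (Fin p) ℝ)) +
        t • (Z - ε • (1 : Matrix (Fin p) (Fin p) ℝ)) := by
    module
  rw [eigSet, Set.mem_ofPred_eq, he]
  exact h

theorem isClosed_eigSet (p : ℕ) (ε : ℝ) : IsClosed (eigSet p ε) :=
  Matrix.isClosed_setOf_posSemidef.preimage (continuous_id.sub continuous_const)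

theorem le_diag_of_mem_eigSet (hX : X ∈ eigSet p ε) (i : Fin p) : ε ≤ X i i := by
  have h := Matrix.PosSemidef.diag_nonneg hX (i := i)
  simpa using h

/-- For `c ≤ 0` the objective decreases from any point of `eigSet` towards `ε I`. -/
theorem logDetSlope_smul_one_sub_le (hε : 0 < ε) {c : ℝ} (hc : c ≤ 0)
    (A : Matrix (Fin p) (Fin p) ℝ) (hX : X ∈ eigSet p ε) :
    logDetSlope c A X (ε • 1 - X) ≤ -(A * (X - ε • 1)).trace := by
  have h := (posDef_of_mem_eigSet hε hX).inv.posSemidef.trace_mul_nonneg hX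
  have h1 := mul_nonneg (neg_nonneg.2 hc) h
  rw [logDetSlope, ← neg_sub X, Matrix.mul_neg, Matrix.mul_neg, Matrix.trace_neg, Matrix.trace_neg]
  linarith

/-- For c ≥ 0, tr(X⁻¹(εI - X)) = ε tr X⁻¹ - p ≥ -p, so the log-determinant part costs at most cp,
uniformly in X. -/
theorem logDetSlope_smul_one_sub_le_abs (hε : 0 < ε) (c : ℝ)
    (A : Matrix (Fin p) (Fin p) ℝ) (hX : X ∈ eigSet p ε) :
    logDetSlope c A X (ε • 1 - X) ≤ |c| * p + ε * A.trace - (A * X).trace := by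
  have hA : (A * (X - ε • 1)).trace = (A * X).trace - ε * A.trace := by
    simp [Matrix.mul_sub]
  have hcp : 0 ≤ |c| * p := by positivity
  rcases le_total c 0 with hc | hc
  · have := logDetSlope_smul_one_sub_le hε hc A hX
    linarith
  · have hpd := posDef_of_mem_eigSet hε hX
    have h1 : 0 ≤ ε * X⁻¹.trace := mul_nonneg hε.le hpd.inv.posSemidef.trace_nonneg
    have h2 : (X⁻¹ * (ε • 1 - X)).trace = ε * X⁻¹.trace - p := by
      rw [Matrix.mul_sub, Matrix.nonsing_inv_mul _ hpd.det_pos.ne'.isUnit]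
      simp
    rw [logDetSlope, h2, ← neg_sub X, Matrix.mul_neg, Matrix.trace_neg, hA, abs_of_nonneg hc]
    nlinarith [mul_nonneg hc h1]

theorem bddBelow_logDetObj (hε : 0 < ε) (c : ℝ) {A : Matrix (Fin p) (Fin p) ℝ} (hA : A.PosDef) :
    ∃ m : ℝ, ∀ X ∈ eigSet p ε, m ≤ logDetObj c A X := by
  rcases le_or_gt c 0 with hc | hc
  · refine ⟨logDetObj c A (ε • 1), fun X hX => ?_⟩
    have h1 := logDetObj_le_tangent hc A (posDef_of_mem_eigSet hε hX) (posDef_smul_one p hε)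
    have h2 := logDetSlope_smul_one_sub_le hε hc A hX
    have h3 := hA.posSemidef.trace_mul_nonneg hX
    linarith
  -- The matrix cA⁻¹ is the unconstrained critical point, where the supporting tangent is flat.
  · refine ⟨logDetObj c A (c • A⁻¹), fun X hX => ?_⟩
    have h1 := logDetObj_tangent_le hc.le A (hA.inv.smul hc) (posDef_of_mem_eigSet hε hX)
    have h2 : (c • A⁻¹)⁻¹ = c⁻¹ • A := by
      refine Matrix.inv_eq_left_inv ?_
      rw [smul_mul_smul_comm, Matrix.mul_nonsing_inv _ hA.det_pos.ne'.isUnit,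
        inv_mul_cancel₀ hc.ne', one_smul]
    have h3 : logDetSlope c A (c • A⁻¹) (X - c • A⁻¹) = 0 := by
      rw [logDetSlope, h2, Matrix.smul_mul, Matrix.trace_smul, smul_eq_mul, neg_mul,
        mul_inv_cancel_left₀ hc.ne', neg_add_cancel]
    linarith

end eigSet

/-! ### The graph constraint set N -/

section graphSet

variable {s : Fin p → Fin p} {G : SimpleGraph (Fin p)} {X Z : Matrix (Fin p) (Fin p) ℝ}

/-- Eliminating κ and β leaves linear equations and a positive diagonal, which makes convexity and
limits of N accessible. -/
theorem mem_graphSet_iff : X ∈ graphSet s G ↔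
    (∀ i, 0 < X i i) ∧ (∀ i j, s i = s j → X i i = X j j) ∧
    (∀ i j k l, G.Adj i j → G.Adj k l → s i = s k → s j = s l → X i j = X k l) ∧
    (∀ i j, i ≠ j → ¬ G.Adj i j → X i j = 0) := by
  classical
  constructor
  · rintro ⟨κ, β, hκ, hκs, hβ, hd, ha, hn⟩
    refine ⟨fun i => ?_, fun i j h => ?_, fun i j k l hij hkl h1 h2 => ?_, hn⟩
    · rw [hd]; exact one_div_pos.2 (hκ i)
    · rw [hd, hd, hκs i j h]
    · rw [ha i j hij, ha k l hkl, hβ i j k l h1 h2, hκs i k h1]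
  · rintro ⟨hpos, hdiag, hadj, hn⟩
    -- β is read off from any edge with the given pair of types; pairs without an edge are
    -- unconstrained and get 0.
    let b : Fin p → Fin p → ℝ := fun u v =>
      if h : ∃ q : Fin p × Fin p, G.Adj q.1 q.2 ∧ s q.1 = u ∧ s q.2 = v then
        -X h.choose.1 h.choose.2 / X h.choose.1 h.choose.1 else 0
    refine ⟨fun i => 1 / X i i, fun i j => b (s i) (s j), fun i => one_div_pos.2 (hpos i),
      fun i j h => by simp only [hdiag i j h], fun i j k l h1 h2 => by simp only [h1, h2],
      fun i => by simp, fun i j hij => ?_, hn⟩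
    have h : ∃ q : Fin p × Fin p, G.Adj q.1 q.2 ∧ s q.1 = s i ∧ s q.2 = s j :=
      ⟨(i, j), hij, rfl, rfl⟩
    obtain ⟨h1, h2, h3⟩ := h.choose_spec
    have hb : b (s i) (s j) = -X i j / X i i := by
      simp only [b, dif_pos h]
      rw [hadj _ _ i j h1 hij h2 h3, hdiag _ i h2]
    have := (hpos i).ne'
    simp only [hb]
    field_simp

theorem smul_one_mem_graphSet (s : Fin p → Fin p) (G : SimpleGraph (Fin p)) {ε : ℝ} (hε : 0 < ε) :
    ε • (1 : Matrix (Fin p) (Fin p) ℝ) ∈ graphSet s G := by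
  refine mem_graphSet_iff.2 ⟨fun i => by simpa using hε, fun i j _ => by simp,
    fun i j k l hij hkl _ _ => by simp [hij.ne, hkl.ne], fun i j hij _ => by simp [hij]⟩

theorem add_smul_sub_mem_graphSet (hX : X ∈ graphSet s G) (hZ : Z ∈ graphSet s G) {t : ℝ}
    (ht0 : 0 ≤ t) (ht1 : t ≤ 1) : X + t • (Z - X) ∈ graphSet s G := by
  rw [mem_graphSet_iff] at hX hZ ⊢
  obtain ⟨x1, x2, x3, x4⟩ := hX
  obtain ⟨z1, z2, z3, z4⟩ := hZ
  simp only [Matrix.add_apply, Matrix.smul_apply, Matrix.sub_apply, smul_eq_mul]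
  refine ⟨fun i => ?_, fun i j h => by rw [x2 i j h, z2 i j h],
    fun i j k l h1 h2 h3 h4 => by rw [x3 i j k l h1 h2 h3 h4, z3 i j k l h1 h2 h3 h4],
    fun i j h1 h2 => by rw [x4 i j h1 h2, z4 i j h1 h2]; simp⟩
  rcases ht0.eq_or_lt with rfl | ht
  · simpa using x1 i
  · nlinarith [mul_pos ht (z1 i), mul_nonneg (sub_nonneg.2 ht1) (x1 i).le]

/-- The only obstruction to closedness of `graphSet` is a vanishing diagonal. -/
theorem mem_graphSet_of_tendsto {ι : Type*} {l : Filter ι} [l.NeBot]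
    {u : ι → Matrix (Fin p) (Fin p) ℝ} (hu : Tendsto u l (𝓝 X)) (hmem : ∀ᶠ k in l, u k ∈ graphSet s G)
    (hdiag : ∀ i, 0 < X i i) : X ∈ graphSet s G := by
  have he : ∀ i j, Tendsto (fun k => u k i j) l (𝓝 (X i j)) := fun i j =>
    ((continuous_id.matrix_elem i j).tendsto X).comp hu
  simp only [mem_graphSet_iff] at hmem
  refine mem_graphSet_iff.2 ⟨hdiag, fun i j h => ?_, fun i j k l h1 h2 h3 h4 => ?_,
    fun i j h1 h2 => ?_⟩
  · exact tendsto_nhds_unique_of_eventuallyEq (he i i) (he j j)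
      (hmem.mono fun k hk => hk.2.1 i j h)
  · exact tendsto_nhds_unique_of_eventuallyEq (he i j) (he k l)
      (hmem.mono fun m hm => hm.2.2.1 i j k l h1 h2 h3 h4)
  · exact tendsto_nhds_unique_of_eventuallyEq (he i j) tendsto_const_nhds
      (hmem.mono fun m hm => hm.2.2.2 i j h1 h2)

end graphSet

end Cargo

/-! ### Quadratic expansions of the Frobenius norm -/

namespace Cargo

variable {p : ℕ}

theorem frobNorm_nonneg (X : Matrix (Fin p) (Fin p) ℝ) : 0 ≤ frobNorm X := Real.sqrt_nonneg _

theorem eq_of_frobNorm_sub_eq_zero {X Y : Matrix (Fin p) (Fin p) ℝ} (h : frobNorm (X - Y) = 0) :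
    X = Y := by
  rw [frobNorm_eq_norm, norm_eq_zero, map_sub, sub_eq_zero] at h
  ext i j
  rw [← frobVec_apply X, ← frobVec_apply Y, h]

theorem frobNorm_sub_comm (X Y : Matrix (Fin p) (Fin p) ℝ) :
    frobNorm (X - Y) = frobNorm (Y - X) := by
  simp only [frobNorm_eq_norm, map_sub, norm_sub_rev]

theorem frobNorm_add_le (X Y : Matrix (Fin p) (Fin p) ℝ) :
    frobNorm (X + Y) ≤ frobNorm X + frobNorm Y := by
  simp only [frobNorm_eq_norm, map_add]
  exact norm_add_le _ _

theorem frobNorm_sub_le (X Y : Matrix (Fin p) (Fin p) ℝ) :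
    frobNorm (X - Y) ≤ frobNorm X + frobNorm Y := by
  simp only [frobNorm_eq_norm, map_sub]
  exact norm_sub_le _ _

theorem frobNorm_smul (t : ℝ) (X : Matrix (Fin p) (Fin p) ℝ) :
    frobNorm (t • X) = |t| * frobNorm X := by
  simp only [frobNorm_eq_norm, map_smul, norm_smul, Real.norm_eq_abs]

theorem frobNorm_add_smul_sub_sq (X D Y : Matrix (Fin p) (Fin p) ℝ) (t : ℝ) :
    frobNorm (X + t • D - Y) ^ 2 = frobNorm (X - Y) ^ 2 +
      2 * t * inner ℝ (frobVec (X - Y)) (frobVec D) + t ^ 2 * frobNorm D ^ 2 := by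
  have h : frobVec (X + t • D - Y) = frobVec (X - Y) + t • frobVec D := by
    rw [← map_smul, ← map_add]; congr 1; abel
  rw [frobNorm_eq_norm, frobNorm_eq_norm, frobNorm_eq_norm, h, norm_add_sq_real, inner_smul_right,
    norm_smul, mul_pow, Real.norm_eq_abs, sq_abs]
  ring

/-- A first-order coefficient is nonnegative if the quadratic is nonnegative on `[0, 1]`. -/
theorem nonneg_of_forall_quadratic_nonneg {α β : ℝ}
    (h : ∀ t : ℝ, 0 ≤ t → t ≤ 1 → 0 ≤ t * α + t ^ 2 * β) : 0 ≤ α := by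
  have hlim : Tendsto (fun t : ℝ => α + t * β) (𝓝[>] 0) (𝓝 α) := by
    have : Continuous fun t : ℝ => α + t * β := by fun_prop
    simpa using (this.tendsto 0).mono_left nhdsWithin_le_nhds
  refine ge_of_tendsto hlim ?_
  filter_upwards [Ioc_mem_nhdsGT (zero_lt_one' ℝ)] with t ht
  have h1 : 0 ≤ t * (α + t * β) := by linarith [h t ht.1.le ht.2]
  exact nonneg_of_mul_nonneg_right h1 ht.1

/-! ### Optimality and descent for the two block steps -/

section Steps

variable {s : Fin p → Fin p} {G : SimpleGraph (Fin p)} {ν : ℝ} {B : Matrix (Fin p) (Fin p) ℝ}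
  {x : Fin p → ℝ} {ε γ : ℝ} {X Y X' Y' Z W : Matrix (Fin p) (Fin p) ℝ}

theorem objective_eq_logDetObj (ν : ℝ) (B : Matrix (Fin p) (Fin p) ℝ) (x : Fin p → ℝ)
    (X : Matrix (Fin p) (Fin p) ℝ) :
    objective ν B x X = logDetObj (ν - p) (B⁻¹ + Matrix.vecMulVec x x) X := rfl

theorem posDef_inv_add_vecMulVec (hB : B.PosDef) (x : Fin p → ℝ) :
    (B⁻¹ + Matrix.vecMulVec x x).PosDef := by
  have h := Matrix.posSemidef_vecMulVec_self_star x
  rw [star_trivial] at h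
  exact hB.inv.add_posSemidef h

theorem X_step_optimality (hε : 0 < ε)
    (h : IsMinimizer (fun Z => penalty ν B x γ Z Y' + 1 / 2 * frobNorm (Z - X') ^ 2)
      (eigSet p ε) X) (hZ : Z ∈ eigSet p ε) :
    0 ≤ logDetSlope (ν - p) (B⁻¹ + Matrix.vecMulVec x x) X (Z - X) +
      (γ * inner ℝ (frobVec (X - Y')) (frobVec (Z - X)) +
        inner ℝ (frobVec (X - X')) (frobVec (Z - X))) := by
  refine logDetSlope_add_nonneg (β := (γ / 2 + 1 / 2) * frobNorm (Z - X) ^ 2)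
    (fun t ht0 ht1 => posDef_of_mem_eigSet hε (add_smul_sub_mem_eigSet h.1 hZ ht0 ht1))
    fun t ht0 ht1 => ?_
  have h1 := h.2 _ (add_smul_sub_mem_eigSet h.1 hZ ht0 ht1)
  simp only [penalty, frobNorm_add_smul_sub_sq, objective_eq_logDetObj] at h1
  linarith

theorem Y_step_optimality
    (h : IsMinimizer (fun W => penalty ν B x γ X W + 1 / 2 * frobNorm (W - Y') ^ 2)
      (graphSet s G) Y) (hW : W ∈ graphSet s G) :
    0 ≤ γ * inner ℝ (frobVec (Y - X)) (frobVec (W - Y)) +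
        inner ℝ (frobVec (Y - Y')) (frobVec (W - Y)) := by
  refine nonneg_of_forall_quadratic_nonneg (β := (γ / 2 + 1 / 2) * frobNorm (W - Y) ^ 2)
    fun t ht0 ht1 => ?_
  have h1 := h.2 _ (add_smul_sub_mem_graphSet h.1 hW ht0 ht1)
  simp only [penalty, frobNorm_sub_comm X, frobNorm_add_smul_sub_sq] at h1
  linarith

/-- The variational inequality that holds when the steps of the last inner iteration are small. -/
theorem approximate_optimality {δ : ℝ} (hε : 0 < ε)
    (hX : IsMinimizer (fun Z => penalty ν B x γ Z Y' + 1 / 2 * frobNorm (Z - X') ^ 2)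
      (eigSet p ε) X)
    (hY : IsMinimizer (fun W => penalty ν B x γ X W + 1 / 2 * frobNorm (W - Y') ^ 2)
      (graphSet s G) Y)
    (h1 : frobNorm ((X - X') + γ • (Y - Y')) ≤ δ) (h2 : frobNorm (Y - Y') ≤ δ)
    (hZ : Z ∈ eigSet p ε ∩ graphSet s G) :
    γ * frobNorm (X - Y) ^ 2 ≤ logDetSlope (ν - p) (B⁻¹ + Matrix.vecMulVec x x) X (Z - X) +
      δ * (frobNorm (Z - X) + frobNorm (Z - Y)) := by
  -- Splitting X - Y' = (X - Y) + (Y - Y') turns the error of the X-step into (X - X') + γ(Y - Y').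
  have hx := X_step_optimality hε hX hZ.1
  have hy := Y_step_optimality hY hZ.2
  have i1 : inner ℝ (frobVec ((X - X') + γ • (Y - Y'))) (frobVec (Z - X)) ≤
      δ * frobNorm (Z - X) := by
    refine (real_inner_le_norm _ _).trans ?_
    rw [← frobNorm_eq_norm, ← frobNorm_eq_norm]
    exact mul_le_mul_of_nonneg_right h1 (frobNorm_nonneg _)
  have i2 : inner ℝ (frobVec (Y - Y')) (frobVec (Z - Y)) ≤ δ * frobNorm (Z - Y) := by
    refine (real_inner_le_norm _ _).trans ?_
    rw [← frobNorm_eq_norm, ← frobNorm_eq_norm]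
    exact mul_le_mul_of_nonneg_right h2 (frobNorm_nonneg _)
  have hn : frobNorm (X - Y) ^ 2 = inner ℝ (frobVec (X - Y)) (frobVec (X - Y)) := by
    rw [frobNorm_eq_norm, real_inner_self_eq_norm_sq]
  rw [hn]
  simp only [map_sub, map_add, map_smul, inner_sub_left, inner_sub_right, inner_add_left,
    inner_smul_left, RCLike.conj_to_real] at hx hy i1 i2 ⊢
  linarith

/-- Each block minimizer is compared with the previous iterate, which must therefore be feasible. -/
theorem descent
    (hX : IsMinimizer (fun Z => penalty ν B x γ Z Y' + 1 / 2 * frobNorm (Z - X') ^ 2)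
      (eigSet p ε) X)
    (hY : IsMinimizer (fun W => penalty ν B x γ X W + 1 / 2 * frobNorm (W - Y') ^ 2)
      (graphSet s G) Y) (hX' : X' ∈ eigSet p ε) (hY' : Y' ∈ graphSet s G) :
    penalty ν B x γ X Y + (1 / 2 * frobNorm (X - X') ^ 2 + 1 / 2 * frobNorm (Y - Y') ^ 2) ≤
      penalty ν B x γ X' Y' := by
  have h0 : frobNorm (0 : Matrix (Fin p) (Fin p) ℝ) = 0 := by
    rw [frobNorm_eq_norm, map_zero, norm_zero]
  have h1 := hX.2 _ hX'
  have h2 := hY.2 _ hY'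
  simp only [sub_self, h0] at h1 h2
  linarith

theorem bddBelow_penalty (hε : 0 < ε) (ν : ℝ) (hB : B.PosDef) (x : Fin p → ℝ) (hγ : 0 ≤ γ) :
    ∃ m : ℝ, ∀ X ∈ eigSet p ε, ∀ Y, m ≤ penalty ν B x γ X Y := by
  obtain ⟨m, hm⟩ := bddBelow_logDetObj hε (ν - p) (posDef_inv_add_vecMulVec hB x)
  refine ⟨m, fun X hX Y => (hm X hX).trans ?_⟩
  rw [← objective_eq_logDetObj, penalty]
  exact le_add_of_nonneg_right (by positivity)

/-- Stationary points of the constrained problem are its unique global minimizers, also when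
`ν ≤ p` and the objective is not convex. -/
theorem isTheMinimizer_of_stationary (hε : 0 < ε) (hB : B.PosDef)
    (hX : X ∈ eigSet p ε ∩ graphSet s G)
    (h : ∀ Z ∈ eigSet p ε ∩ graphSet s G,
      0 ≤ logDetSlope (ν - p) (B⁻¹ + Matrix.vecMulVec x x) X (Z - X)) :
    IsTheMinimizer (objective ν B x) (eigSet p ε ∩ graphSet s G) X := by
  have hA := posDef_inv_add_vecMulVec hB x
  rcases le_or_gt (ν - p) 0 with hc | hc
  -- Concave case: the slope towards εI is at most -a tr(Z - εI), and this trace vanishes on M only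
  -- at Z = εI.
  · obtain ⟨a, ha, haA⟩ := hA.exists_pos_smul_trace_le
    have hmem : ε • 1 ∈ eigSet p ε ∩ graphSet s G :=
      ⟨smul_one_mem_eigSet p ε, smul_one_mem_graphSet s G hε⟩
    have heq : ∀ Z ∈ eigSet p ε, (Z - ε • 1).trace ≤ 0 → Z = ε • 1 := fun Z hZ htr =>
      sub_eq_zero.1 ((Matrix.PosSemidef.trace_eq_zero_iff hZ).1
        (le_antisymm htr (Matrix.PosSemidef.trace_nonneg hZ)))
    have hslope : ∀ Z ∈ eigSet p ε,
        logDetSlope (ν - p) (B⁻¹ + Matrix.vecMulVec x x) Z (ε • 1 - Z) ≤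
          -(a * (Z - ε • 1).trace) := fun Z hZ =>
      (logDetSlope_smul_one_sub_le hε hc _ hZ).trans (neg_le_neg (haA _ hZ))
    have hobj : ∀ Z ∈ eigSet p ε,
        objective ν B x (ε • 1) ≤ objective ν B x Z - a * (Z - ε • 1).trace := fun Z hZ => by
      have := logDetObj_le_tangent hc (B⁻¹ + Matrix.vecMulVec x x)
        (posDef_of_mem_eigSet hε hZ) (posDef_smul_one p hε)
      rw [objective_eq_logDetObj, objective_eq_logDetObj]
      linarith [hslope Z hZ]
    have hX1 : X = ε • 1 := by
      refine heq X hX.1 (nonpos_of_mul_nonpos_right (?_ : a * _ ≤ 0) ha)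
      linarith [h _ hmem, hslope X hX.1]
    subst hX1
    refine ⟨⟨hX, fun Z hZ => ?_⟩, fun Z hZ => ?_⟩
    · have := mul_nonneg ha.le (Matrix.PosSemidef.trace_nonneg hZ.1)
      linarith [hobj Z hZ.1]
    · refine heq Z hZ.1.1 (nonpos_of_mul_nonpos_right (?_ : a * _ ≤ 0) ha)
      linarith [hobj Z hZ.1.1, hZ.2 _ hX]
  · have hpd := posDef_of_mem_eigSet hε hX.1
    refine ⟨⟨hX, fun Z hZ => ?_⟩, fun Z hZ => ?_⟩
    · have := logDetObj_tangent_le hc.le (B⁻¹ + Matrix.vecMulVec x x) hpd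
        (posDef_of_mem_eigSet hε hZ.1)
      rw [objective_eq_logDetObj, objective_eq_logDetObj]
      linarith [h Z hZ]
    · refine eq_of_logDetObj_tangent_eq hc (B⁻¹ + Matrix.vecMulVec x x) hpd
        (posDef_of_mem_eigSet hε hZ.1.1) ?_
      have := hZ.2 X hX
      rw [objective_eq_logDetObj, objective_eq_logDetObj] at this
      linarith [h Z hZ.1]

end Steps

/-! ### Termination of inner loops and a priori estimates -/

theorem tendsto_zero_of_sq {f : ℕ → ℝ} (hf : ∀ n, 0 ≤ f n)
    (h : Tendsto (fun n => f n ^ 2) atTop (𝓝 0)) : Tendsto f atTop (𝓝 0) := by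
  have := h.sqrt
  simpa [Real.sqrt_sq, hf] using this

/-- Sufficient decrease of a sequence bounded below forces the decrements to vanish. -/
theorem tendsto_zero_of_add_le {φ d : ℕ → ℝ} {m : ℝ} (hm : ∀ l, m ≤ φ l) (hd : ∀ l, 0 ≤ d l)
    (h : ∀ l, φ (l + 1) + d l ≤ φ l) : Tendsto d atTop (𝓝 0) := by
  have hanti : Antitone φ := antitone_nat_of_succ_le fun l => by linarith [h l, hd l]
  have hlim := tendsto_atTop_ciInf hanti ⟨m, by rintro _ ⟨l, rfl⟩; exact hm l⟩
  have hdiff : Tendsto (fun l => φ l - φ (l + 1)) atTop (𝓝 0) := by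
    simpa using hlim.sub ((tendsto_add_atTop_iff_nat 1).2 hlim)
  exact squeeze_zero hd (fun l => by linarith [h l]) hdiff

namespace IsRun

variable {s : Fin p → Fin p} {G : SimpleGraph (Fin p)} {ν : ℝ} {B : Matrix (Fin p) (Fin p) ℝ}
  {x : Fin p → ℝ} {ε γ₀ η : ℝ} {tol : ℕ → ℝ} {X Y : ℕ → Matrix (Fin p) (Fin p) ℝ}
  {XI YI : ℕ → ℕ → Matrix (Fin p) (Fin p) ℝ}

theorem exists_exitsAt (hrun : IsRun s G ν B x ε γ₀ η tol X Y XI YI) (hB : B.PosDef) (hε : 0 < ε)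
    (hγ₀ : 0 < γ₀) (hη : 0 < η) (k : ℕ) (htol : 0 < tol k) :
    ∃ L, ExitsAt (η ^ k * γ₀) (tol k) (XI k) (YI k) L := by
  by_contra hno
  have hcont : ∀ l, Continues (η ^ k * γ₀) (tol k) (XI k) (YI k) l := by
    intro l
    induction l using Nat.strong_induction_on with
    | _ l ih => exact by_contra fun hl => hno ⟨l, ih, hl⟩
  set γ := η ^ k * γ₀ with hγdef
  have hγ : 0 < γ := by positivity
  have hX := fun l => hrun.X_step k l fun j _ => hcont j
  have hY := fun l => hrun.Y_step k l fun j _ => hcont j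
  obtain ⟨m, hm⟩ := bddBelow_penalty hε ν hB x hγ.le
  -- The descent is counted from the first computed pair, since the starting pair may be infeasible:
  -- I is outside M when ε > 1 and p > 0, and `Y 0` need not lie in N.
  have hd := tendsto_zero_of_add_le (φ := fun l => penalty ν B x γ (XI k (l + 1)) (YI k (l + 1)))
    (fun l => hm _ (hX l).1 _) (fun l => by positivity)
    fun l => descent (hX (l + 1)) (hY (l + 1)) (hX l).1 (hY l).1
  have hdX : Tendsto (fun l => frobNorm (XI k (l + 1 + 1) - XI k (l + 1))) atTop (𝓝 0) := by
    refine tendsto_zero_of_sq (fun _ => frobNorm_nonneg _) ?_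
    refine squeeze_zero (fun _ => sq_nonneg _) (fun l => ?_) (by simpa using hd.const_mul 2)
    nlinarith [sq_nonneg (frobNorm (YI k (l + 1 + 1) - YI k (l + 1)))]
  have hdY : Tendsto (fun l => frobNorm (YI k (l + 1 + 1) - YI k (l + 1))) atTop (𝓝 0) := by
    refine tendsto_zero_of_sq (fun _ => frobNorm_nonneg _) ?_
    refine squeeze_zero (fun _ => sq_nonneg _) (fun l => ?_) (by simpa using hd.const_mul 2)
    nlinarith [sq_nonneg (frobNorm (XI k (l + 1 + 1) - XI k (l + 1)))]
  have h1 : Tendsto (fun l => frobNorm (XI k (l + 1 + 1) - XI k (l + 1)) +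
      γ * frobNorm (YI k (l + 1 + 1) - YI k (l + 1))) atTop (𝓝 0) := by
    simpa using hdX.add (hdY.const_mul γ)
  obtain ⟨l, hl1, hl2⟩ :=
    ((h1.eventually (gt_mem_nhds htol)).and (hdY.eventually (gt_mem_nhds htol))).exists
  rcases hcont (l + 1 + 1) with h | h
  · omega
  · rw [Nat.add_sub_cancel] at h
    refine h.not_ge (max_le ?_ hl2.le)
    refine (frobNorm_add_le _ _).trans ?_
    rw [frobNorm_smul, abs_of_pos hγ]
    exact hl1.le

/-- What holds for the outer iterates whenever the inner loop has been left. -/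
theorem outer_optimality (hrun : IsRun s G ν B x ε γ₀ η tol X Y XI YI) (hε : 0 < ε) {k L : ℕ}
    (hL : ExitsAt (η ^ k * γ₀) (tol k) (XI k) (YI k) L) :
    X (k + 1) ∈ eigSet p ε ∧ Y (k + 1) ∈ graphSet s G ∧
      ∀ Z ∈ eigSet p ε ∩ graphSet s G,
        η ^ k * γ₀ * frobNorm (X (k + 1) - Y (k + 1)) ^ 2 ≤
          logDetSlope (ν - p) (B⁻¹ + Matrix.vecMulVec x x) (X (k + 1)) (Z - X (k + 1)) +
            tol k * (frobNorm (Z - X (k + 1)) + frobNorm (Z - Y (k + 1))) := by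
  obtain ⟨hlt, hex⟩ := id hL
  rw [Continues, not_or, not_lt, max_le_iff] at hex
  obtain ⟨hL0, h1, h2⟩ := hex
  obtain ⟨l, rfl⟩ := Nat.exists_eq_succ_of_ne_zero hL0
  have hX := hrun.X_step k l fun j hj => hlt j (Nat.lt_succ_of_le hj)
  have hY := hrun.Y_step k l fun j hj => hlt j (Nat.lt_succ_of_le hj)
  rw [hrun.X_succ k _ hL, hrun.Y_succ k _ hL]
  exact ⟨hX.1, hY.1, fun Z hZ => approximate_optimality hε hX hY h1 h2 hZ⟩

/-- The a priori estimate from which boundedness and asymptotic feasibility follow. -/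
theorem exists_apriori_bound (hrun : IsRun s G ν B x ε γ₀ η tol X Y XI YI) (hB : B.PosDef)
    (hε : 0 < ε) (hγ₀ : 0 < γ₀) (hη : 1 < η) (htol_pos : ∀ k, 0 < tol k)
    (htol_lim : Tendsto tol atTop (𝓝 0)) :
    ∃ a K : ℝ, 0 < a ∧ ∀ᶠ k in atTop, a * frobNorm (X (k + 1)) +
      η ^ k * γ₀ * frobNorm (X (k + 1) - Y (k + 1)) ^ 2 ≤ K := by
  have hA := posDef_inv_add_vecMulVec hB x
  obtain ⟨a, ha, haA⟩ := hA.exists_pos_smul_trace_le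
  set A := B⁻¹ + Matrix.vecMulVec x x with hAdef
  set I : Matrix (Fin p) (Fin p) ℝ := ε • 1 with hI
  set C := |ν - p| * p + ε * A.trace with hC
  -- With u = ‖X‖ and d = ‖X - Y‖, the error is at most 2‖εI‖ + (a/2)u + d once the tolerance is
  -- below 1 and a/4. As d ≤ (1 + d²)/2 and γ ≥ 1, half of the left side absorbs the u and d² terms;
  -- doubling gives the constant.
  refine ⟨a, 2 * (C + 2 * frobNorm I + 1 / 2), ha, ?_⟩
  have hγ : ∀ᶠ k in atTop, 1 ≤ η ^ k * γ₀ :=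
    ((tendsto_pow_atTop_atTop_of_one_lt hη).atTop_mul_const hγ₀).eventually_ge_atTop 1
  filter_upwards [hγ, htol_lim.eventually (gt_mem_nhds one_pos),
    htol_lim.eventually (gt_mem_nhds (show 0 < a / 4 by positivity))] with k h1 h2 h3
  obtain ⟨L, hL⟩ := hrun.exists_exitsAt hB hε hγ₀ (one_pos.trans hη) k (htol_pos k)
  obtain ⟨hX, -, hopt⟩ := hrun.outer_optimality hε hL
  have h4 := hopt I ⟨smul_one_mem_eigSet p ε, smul_one_mem_graphSet s G hε⟩
  have h5 := logDetSlope_smul_one_sub_le_abs hε (ν - p) A hX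
  have hpsd := (posDef_of_mem_eigSet hε hX).posSemidef
  have h6 : a * frobNorm (X (k + 1)) ≤ (A * X (k + 1)).trace :=
    (mul_le_mul_of_nonneg_left (frobNorm_le_trace hpsd) ha.le).trans (haA _ hpsd)
  have h7 := frobNorm_sub_le I (X (k + 1))
  have h8 : frobNorm (I - Y (k + 1)) ≤ frobNorm I + frobNorm (X (k + 1)) +
      frobNorm (X (k + 1) - Y (k + 1)) := by
    have := frobNorm_add_le (I - X (k + 1)) (X (k + 1) - Y (k + 1))
    rw [sub_add_sub_cancel] at this
    linarith
  set u := frobNorm (X (k + 1))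
  set d := frobNorm (X (k + 1) - Y (k + 1))
  set e := frobNorm I
  have hu : 0 ≤ u := frobNorm_nonneg _
  have hd : 0 ≤ d := frobNorm_nonneg _
  have he : 0 ≤ e := frobNorm_nonneg _
  have h9 : tol k * (frobNorm (I - X (k + 1)) + frobNorm (I - Y (k + 1))) ≤
      tol k * (2 * e + 2 * u + d) := mul_le_mul_of_nonneg_left (by linarith) (htol_pos k).le
  have h10 : tol k * e ≤ e := mul_le_of_le_one_left he h2.le
  have h11 : tol k * d ≤ d := mul_le_of_le_one_left hd h2.le
  have h12 : tol k * u ≤ a / 4 * u := mul_le_mul_of_nonneg_right h3.le hu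
  have h13 : d ^ 2 ≤ η ^ k * γ₀ * d ^ 2 := le_mul_of_one_le_left (sq_nonneg d) h1
  linarith [sq_nonneg (d - 1)]

end IsRun

end Cargo

/-! ### Boundedness, asymptotic feasibility and accumulation points -/

theorem theorem5 {p : ℕ} (s : Fin p → Fin p) (G : SimpleGraph (Fin p))
    (ν : ℝ) (hν : (p : ℝ) - 1 < ν)
    (B : Matrix (Fin p) (Fin p) ℝ) (hB : B.PosDef) (x : Fin p → ℝ)
    (ε : ℝ) (hε : 0 < ε) (γ₀ : ℝ) (hγ₀ : 0 < γ₀) (η : ℝ) (hη : 1 < η)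
    (tol : ℕ → ℝ) (htol_pos : ∀ k, 0 < tol k) (htol_anti : Antitone tol)
    (htol_lim : Tendsto tol atTop (𝓝 0))
    (X Y : ℕ → Matrix (Fin p) (Fin p) ℝ) (XI YI : ℕ → ℕ → Matrix (Fin p) (Fin p) ℝ)
    (hrun : Cargo.IsRun s G ν B x ε γ₀ η tol X Y XI YI) :
    -- every inner loop is left after finitely many steps
    (∀ k, ∃ L, Cargo.ExitsAt (η ^ k * γ₀) (tol k) (XI k) (YI k) L) ∧
    -- the outer sequence is bounded
    (∃ C : ℝ, ∀ k, Cargo.frobNorm (X k) ≤ C ∧ Cargo.frobNorm (Y k) ≤ C) ∧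
    -- the two blocks become equal in the limit
    Tendsto (fun k => Cargo.frobNorm (X k - Y k)) atTop (𝓝 0) ∧
    -- accumulation points
    (∀ Xs Ys : Matrix (Fin p) (Fin p) ℝ,
      MapClusterPt (Xs, Ys) atTop (fun k => (X k, Y k)) →
        Xs = Ys ∧
        Cargo.IsTheMinimizer (Cargo.objective ν B x)
          (Cargo.eigSet p ε ∩ Cargo.graphSet s G) Xs) := by
  open Cargo in
  have hexit : ∀ k, ∃ L, ExitsAt (η ^ k * γ₀) (tol k) (XI k) (YI k) L := fun k =>
    hrun.exists_exitsAt hB hε hγ₀ (one_pos.trans hη) k (htol_pos k)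
  have hopt := fun k => hrun.outer_optimality hε (hexit k).choose_spec
  obtain ⟨a, K, ha, haK⟩ := hrun.exists_apriori_bound hB hε hγ₀ hη htol_pos htol_lim
  have hγ : Tendsto (fun k : ℕ => η ^ k * γ₀) atTop atTop :=
    (tendsto_pow_atTop_atTop_of_one_lt hη).atTop_mul_const hγ₀
  have hdiff : Tendsto (fun k => frobNorm (X k - Y k)) atTop (𝓝 0) := by
    refine (tendsto_add_atTop_iff_nat 1).1 (tendsto_zero_of_sq (fun _ => frobNorm_nonneg _) ?_)
    refine squeeze_zero' (.of_forall fun _ => sq_nonneg _) ?_ (hγ.const_div_atTop K)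
    filter_upwards [haK, hγ.eventually_gt_atTop 0] with k hk hk0
    rw [le_div_iff₀ hk0, mul_comm]
    have := mul_nonneg ha.le (frobNorm_nonneg (X (k + 1)))
    linarith
  have hbdd : ∃ C : ℝ, ∀ k, frobNorm (X k) ≤ C ∧ frobNorm (Y k) ≤ C := by
    -- An eventual bound is enough: the finitely many remaining iterates are bounded anyway.
    have hb : IsBoundedUnder (· ≤ ·) atTop fun k => max (frobNorm (X k)) (frobNorm (Y k)) := by
      refine ⟨K / a + 1, ?_⟩
      rw [eventually_map, ← map_add_atTop_eq_nat 1, eventually_map]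
      filter_upwards [haK, hγ.eventually_gt_atTop 0,
        ((tendsto_add_atTop_iff_nat 1).2 hdiff).eventually (gt_mem_nhds one_pos)] with k hk hk0 hk1
      have h1 : frobNorm (X (k + 1)) ≤ K / a := by
        rw [le_div_iff₀ ha, mul_comm]
        have := mul_nonneg hk0.le (sq_nonneg (frobNorm (X (k + 1) - Y (k + 1))))
        linarith
      have h2 := frobNorm_sub_le (X (k + 1)) (X (k + 1) - Y (k + 1))
      rw [sub_sub_cancel] at h2
      exact max_le (by linarith) (by linarith)
    obtain ⟨C, hC⟩ := hb.bddAbove_range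
    exact ⟨C, fun k => max_le_iff.1 (hC ⟨k, rfl⟩)⟩
  refine ⟨hexit, hbdd, hdiff, fun Xs Ys hcl => ?_⟩
  obtain ⟨U, hU, hlim⟩ := mapClusterPt_iff_ultrafilter.1 hcl
  have hlX : Tendsto X U (𝓝 Xs) := (continuous_fst.tendsto _).comp hlim
  have hlY : Tendsto Y U (𝓝 Ys) := (continuous_snd.tendsto _).comp hlim
  have heq : Xs = Ys := eq_of_frobNorm_sub_eq_zero (tendsto_nhds_unique
    ((continuous_frobNorm.tendsto _).comp (hlX.sub hlY)) (hdiff.mono_left hU))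
  subst heq
  -- The optimality estimates hold from index 1 on, hence the shift to k - 1 below.
  have hone : ∀ᶠ k in (U : Filter ℕ), 1 ≤ k := hU (eventually_ge_atTop 1)
  have hM : Xs ∈ eigSet p ε := (isClosed_eigSet p ε).mem_of_tendsto hlX <| hone.mono fun k hk => by
    simpa [Nat.sub_add_cancel hk] using (hopt (k - 1)).1
  have hN : Xs ∈ graphSet s G := mem_graphSet_of_tendsto hlY
    (hone.mono fun k hk => by simpa [Nat.sub_add_cancel hk] using (hopt (k - 1)).2.1)
    fun i => hε.trans_le (le_diag_of_mem_eigSet hM i)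
  refine ⟨rfl, isTheMinimizer_of_stationary hε hB ⟨hM, hN⟩ fun Z hZ => ?_⟩
  have htol : Tendsto (fun k => tol (k - 1)) U (𝓝 0) :=
    (htol_lim.comp (tendsto_sub_atTop_nat 1)).mono_left hU
  have hnorm : ∀ {u : ℕ → Matrix (Fin p) (Fin p) ℝ}, Tendsto u U (𝓝 Xs) →
      Tendsto (fun k => frobNorm (Z - u k)) U (𝓝 (frobNorm (Z - Xs))) := fun hu =>
    (continuous_frobNorm.tendsto _).comp (hu.const_sub Z)
  have hlimit := (tendsto_logDetSlope (ν - p) (B⁻¹ + Matrix.vecMulVec x x)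
    (posDef_of_mem_eigSet hε hM) hlX (hlX.const_sub Z)).add
      (htol.mul ((hnorm hlX).add (hnorm hlY)))
  rw [zero_mul, add_zero] at hlimit
  refine ge_of_tendsto hlimit (hone.mono fun k hk => ?_)
  have h := (hopt (k - 1)).2.2 Z hZ
  rw [Nat.sub_add_cancel hk] at h
  -- The penalty term is nonnegative and can be dropped, so no rate for γ‖X - Y‖² is needed.
  exact le_trans (by positivity) h
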